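/- Let $\Omega=\{z\in\mathbb{Z}_{\ge 0}^{\mathbb{Z}_{<0}} : \exists N>0 \text{ such that } z_{-i}=0 \text{ for all } i\ge N\}$. Then for every $n\in\mathbb{Z}$ and all real $Q,y$ with $0<Q<1$ and $Q<y\le 1$, $$Z_n(Q,y)=\sum_{z\in\Omega}\ \prod_{i=1}^{\infty} y^{\mathbf 1_{\{z_{-i}>0\}}\left(n+i-\sum_{j=i}^{\infty} z_{-j}\right)}\,Q^{\,i z_{-i}},$$ where $$Z_n(Q,y)=1+\sum_{L,R>0} y^{nL+(n-1)R}\sum_{\substack{\ell_1,\dots,\ell_L\ge 1\\ m_1,\dots,m_R\ge 1}}\mathbf 1_{\left\{\sum_{j=1}^R m_j=\sum_{j=1}^L \ell_j\right\}}\,A(\ell)\,B(m)\left(y^{-n}+(1-y^{-n})\,y^{R-L}\,Q^{\ell_1+\cdots+\ell_L}\,Q^{m_1+\cdots+m_R}\right),$$ $$A(\ell)=\prod_{j=1}^{L}\frac{Q^{\frac12\ell_j(\ell_j-1)}\left(y^{-(L-j+1)}Q^{\ell_j+\cdots+\ell_L}\right)^{\ell_{j-1}+1}}{1-y^{-(L-j+1)}Q^{\ell_j+\cdots+\ell_L}},\qquad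 B(m)=\prod_{j=1}^{R}\frac{Q^{\frac12 m_j(m_j-1)}\left(y^{R-j+1}Q^{m_j+\cdots+m_R}\right)^{m_{j-1}+1}}{1-y^{R-j+1}Q^{m_j+\cdots+m_R}},$$ with the conventions $\ell_0=-1$ and $m_0=0$. The sum over $\Omega$ and the multiple sum (over all $L,R,\ell,m$ jointly) both converge absolutely. -/

import Mathlib

namespace IsingIdentity

/-- The set `ℤ_{<0}` of negative integers. -/
abbrev NegInt : Type := {k : ℤ // k < 0}

/-- The site `-i ∈ ℤ_{<0}`, for an integer `i ≥ 1`. -/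
def site (i : ℕ+) : NegInt := ⟨-(i : ℤ), by have := i.pos; omega⟩

/-- The configurations `ω : ℤ_{<0} → ℤ_{≥0}` that vanish at `-i` for all large `i`. -/
def Omega : Set (NegInt → ℕ) := {ω | ∃ N : ℕ+, ∀ i : ℕ+, N ≤ i → ω (site i) = 0}

/-- The weight of a configuration `z ∈ Ω`: the product over `i ≥ 1` of
`y ^ (1{z_{-i} > 0} (n + i - ∑_{j ≥ i} z_{-j})) * Q ^ (i z_{-i})`.
On `Ω` all but finitely many factors are `1` and the inner sum has finite support. -/
noncomputable def configWeight (n : ℤ) (Q y : ℝ) (z : NegInt → ℕ) : ℝ :=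
  ∏ᶠ i : ℕ+,
    y ^ ((if 0 < z (site i) then 1 else 0) *
        (n + (i : ℤ) - ∑ᶠ (j : ℕ+) (_ : i ≤ j), (z (site j) : ℤ))) *
      Q ^ ((i : ℕ) * z (site i))

/-- `a_{j-1}` for a tuple `a_1, …, a_K`, where `a_0` is prescribed. The index `j : Fin K` counts
from `0`, so it stands for the position `j + 1` of the tuple. -/
def pred {K : ℕ} (a₀ : ℤ) (a : Fin K → ℕ+) (j : Fin K) : ℤ :=
  (Fin.cons a₀ (fun k => ((a k : ℕ) : ℤ)) : Fin (K + 1) → ℤ) j.castSucc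

/-- `a_j + ⋯ + a_K`. -/
def tailSum {K : ℕ} (a : Fin K → ℕ+) (j : Fin K) : ℕ := ∑ k ∈ Finset.Ici j, (a k : ℕ)

/-- `a_1 + ⋯ + a_K`. -/
def total {K : ℕ} (a : Fin K → ℕ+) : ℕ := ∑ k, (a k : ℕ)

/-- `∏_{j=1}^K Q^{a_j (a_j - 1)/2} (x^{K-j+1} Q^{a_j + ⋯ + a_K})^{a_{j-1} + 1} /
(1 - x^{K-j+1} Q^{a_j + ⋯ + a_K})`, with prescribed `a_0`. The position `j` of the formula is
`j + 1` here, so that `K - j + 1` becomes `K - j`; the division by `2` is exact. -/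
noncomputable def runProd (Q x : ℝ) (a₀ : ℤ) {K : ℕ} (a : Fin K → ℕ+) : ℝ :=
  ∏ j : Fin K,
    Q ^ ((a j : ℕ) * ((a j : ℕ) - 1) / 2) *
        (x ^ (K - (j : ℕ)) * Q ^ tailSum a j) ^ (pred a₀ a j + 1) /
      (1 - x ^ (K - (j : ℕ)) * Q ^ tailSum a j)

/-- The indices of the multiple sum: `L, R > 0` with `ℓ_1, …, ℓ_L ≥ 1` and `m_1, …, m_R ≥ 1`. -/
abbrev RunIndex : Type :=
  Σ p : ℕ+ × ℕ+, (Fin (p.1 : ℕ) → ℕ+) × (Fin (p.2 : ℕ) → ℕ+)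

/-- The summand of the multiple sum, with `ℓ_0 = -1` and `m_0 = 0`. -/
noncomputable def runTerm (n : ℤ) (Q y : ℝ) (L R : ℕ) (ℓ : Fin L → ℕ+) (m : Fin R → ℕ+) : ℝ :=
  y ^ (n * (L : ℤ) + (n - 1) * (R : ℤ)) *
    (if total m = total ℓ then 1 else 0) *
    runProd Q y⁻¹ (-1) ℓ * runProd Q y 0 m *
    (y ^ (-n) + (1 - y ^ (-n)) * y ^ ((R : ℤ) - (L : ℤ)) * Q ^ total ℓ * Q ^ total m)

/-- The summand of the multiple sum as a function of the joint index. -/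
noncomputable def runFamily (n : ℤ) (Q y : ℝ) (t : RunIndex) : ℝ :=
  runTerm n Q y t.1.1 t.1.2 t.2.1 t.2.2

/-- The multiple sum `Z_n(Q, y)`. -/
noncomputable def Zn (n : ℤ) (Q y : ℝ) : ℝ := 1 + ∑' t : RunIndex, runFamily n Q y t

end IsingIdentity

/-!
Both sides count the same Maya diagrams, once through the gaps between consecutive particles and
once through the particles and holes that are displaced from the ground state.

A configuration `z ∈ Ω` gives the increasing sequence of particle positions
`q k = k - ∑_{j > k} z_{-j}` (`k ≥ 0`), where `z_{-(k + 1)}` is the number of holes between the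
particles `k` and `k + 1`, and `q k = k` for large `k` (`IsProfile`). The diagram is determined by
the finite sets `S = {b | -b - 1 is a particle}` and `T = {a | a is a hole}` (`IsMaya`), and every
pair of finite sets of equal size arises from exactly one `z` (`exists_config`). The identity
`sum_isMaya`, which exchanges particles for holes, turns `∑ i * z_{-i}` into
`|S| + ∑ S + ∑ T`, and the exponent of `y` into a sum over the right ends of the particle blocks:
the first elements of the runs of consecutive integers in `S` and in `T`, where a block end at the
origin is counted once if `0 ∈ S` and `0 ∈ T` and not at all if only one of them holds
(`energy_isMaya`, `exponent_isMaya`).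

A finite set is the same as a list of run lengths and gaps (`ofRuns`). For fixed run lengths the sum
over the gaps is a product of geometric series, which is `A(ℓ)` for `S` and `B(m)` for `T + 1`
(`hasSum_runWeight_shift`). The correction at the origin is `y ^ (-n)` unless `0` lies in
neither set; the pairs of the latter kind are the translates by one site of all pairs, and
translation multiplies the weight by `y ^ (R - L) * Q ^ (|S| + |T|)`, which gives the last factor of
the summand (`hasSum_mayaWeight`).

All weights are nonnegative. Each `b ∈ S` and each `a ∈ T` contributes at most a constant times
`(Q / y) ^ b` or `(Q / y) ^ a`, so the sum over all pairs of finite sets is dominated by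
the expansion of a convergent infinite product (`summable_freeWeight`).
-/

namespace IsingIdentity

/-! ### Runs of consecutive integers -/

/-- The first elements of the maximal runs of consecutive integers in `S`. -/
def runStarts (S : Finset ℕ) : Finset ℕ := S.filter fun b => ∀ c ∈ S, c + 1 ≠ b

/-- The translate `S + c`. -/
def shift (c : ℕ) (S : Finset ℕ) : Finset ℕ := S.map (addRightEmbedding c)

/-- The weight `Q ^ (∑ b ∈ S, b) * x ^ (∑ of the run starts of S)`. -/
noncomputable def runWeight (Q x : ℝ) (S : Finset ℕ) : ℝ :=
  Q ^ (∑ b ∈ S, b) * x ^ (∑ b ∈ runStarts S, b)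

lemma mem_runStarts {S : Finset ℕ} {b : ℕ} :
    b ∈ runStarts S ↔ b ∈ S ∧ ∀ c ∈ S, c + 1 ≠ b := by
  simp [runStarts]

lemma mem_shift {c : ℕ} {S : Finset ℕ} {b : ℕ} : b ∈ shift c S ↔ ∃ a ∈ S, a + c = b := by
  simp [shift]

lemma card_shift (c : ℕ) (S : Finset ℕ) : (shift c S).card = S.card := by
  simp [shift]

lemma sum_shift (c : ℕ) (S : Finset ℕ) : ∑ b ∈ shift c S, b = ∑ b ∈ S, b + S.card * c := by
  simp [shift, Finset.sum_add_distrib]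

lemma runStarts_shift (c : ℕ) (S : Finset ℕ) : runStarts (shift c S) = shift c (runStarts S) := by
  ext b
  simp only [mem_runStarts, mem_shift]
  constructor
  · rintro ⟨⟨a, ha, rfl⟩, h⟩
    exact ⟨a, ⟨ha, fun d hd hda => h (d + c) ⟨d, hd, rfl⟩ (by omega)⟩, rfl⟩
  · rintro ⟨a, ⟨ha, h⟩, rfl⟩
    refine ⟨⟨a, ha, rfl⟩, ?_⟩
    rintro _ ⟨d, hd, rfl⟩ hda
    exact h d hd (by omega)

lemma runWeight_shift (Q x : ℝ) (c : ℕ) (S : Finset ℕ) :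
    runWeight Q x (shift c S) = (x ^ (runStarts S).card * Q ^ S.card) ^ c * runWeight Q x S := by
  simp only [runWeight, runStarts_shift, sum_shift]
  ring

/-! ### Finite sets encoded by run lengths and gaps -/

/-- The run `[g, g + l)` followed by a copy of `A` moved beyond the first site after that run. -/
def consRun (g l : ℕ) (A : Finset ℕ) : Finset ℕ := Finset.Ico g (g + l) ∪ shift (g + l + 1) A

lemma mem_consRun {g l : ℕ} {A : Finset ℕ} {b : ℕ} :
    b ∈ consRun g l A ↔ (g ≤ b ∧ b < g + l) ∨ ∃ a ∈ A, a + (g + l + 1) = b := by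
  simp [consRun, mem_shift]

lemma disjoint_consRun (g l : ℕ) (A : Finset ℕ) :
    Disjoint (Finset.Ico g (g + l)) (shift (g + l + 1) A) := by
  rw [Finset.disjoint_left]
  intro b hb hb'
  obtain ⟨a, -, rfl⟩ := mem_shift.1 hb'
  simp at hb
  omega

lemma card_consRun (g l : ℕ) (A : Finset ℕ) : (consRun g l A).card = l + A.card := by
  rw [consRun, Finset.card_union_of_disjoint (disjoint_consRun g l A), card_shift]
  simp

lemma runStarts_consRun (g : ℕ) {l : ℕ} (hl : 0 < l) (A : Finset ℕ) :
    runStarts (consRun g l A) = insert g (shift (g + l + 1) (runStarts A)) := by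
  ext b
  simp only [Finset.mem_insert, mem_runStarts, mem_shift, mem_consRun]
  constructor
  · rintro ⟨⟨h1, h2⟩ | ⟨a, ha, rfl⟩, h⟩
    · left
      by_contra hb
      exact h (b - 1) (Or.inl ⟨by omega, by omega⟩) (by omega)
    · right
      exact ⟨a, ⟨ha, fun c hc hca => h _ (Or.inr ⟨c, hc, rfl⟩) (by omega)⟩, rfl⟩
  · rintro (rfl | ⟨a, ⟨ha, h⟩, rfl⟩)
    · refine ⟨Or.inl ⟨le_rfl, by omega⟩, ?_⟩
      rintro c (hc | ⟨a, -, rfl⟩) <;> omega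
    · refine ⟨Or.inr ⟨a, ha, rfl⟩, ?_⟩
      rintro c (hc | ⟨d, hd, rfl⟩) hca
      · omega
      · exact h d hd (by omega)

lemma notMem_shift_self (g l : ℕ) (A : Finset ℕ) : g ∉ shift (g + l + 1) A := by
  rw [mem_shift]
  rintro ⟨a, -, h⟩
  omega

lemma card_runStarts_consRun (g : ℕ) {l : ℕ} (hl : 0 < l) (A : Finset ℕ) :
    (runStarts (consRun g l A)).card = (runStarts A).card + 1 := by
  rw [runStarts_consRun g hl, Finset.card_insert_of_notMem (notMem_shift_self g l _), card_shift]

lemma sum_Ico_add (g l : ℕ) : ∑ b ∈ Finset.Ico g (g + l), b = l * g + l * (l - 1) / 2 := by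
  rw [Finset.sum_Ico_eq_sum_range]
  rw [Nat.add_sub_cancel_left, Finset.sum_add_distrib, Finset.sum_range_id]
  simp

lemma runWeight_consRun (Q x : ℝ) (g : ℕ) {l : ℕ} (hl : 0 < l) (A : Finset ℕ) :
    runWeight Q x (consRun g l A) =
      Q ^ (l * (l - 1) / 2) * (x ^ ((runStarts A).card + 1) * Q ^ (l + A.card)) ^ g *
        runWeight Q x (shift (l + 1) A) := by
  have h1 : ∑ b ∈ consRun g l A, b =
      (l * g + l * (l - 1) / 2) + (∑ b ∈ A, b + A.card * (g + l + 1)) := by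
    rw [consRun, Finset.sum_union (disjoint_consRun g l A), sum_shift, sum_Ico_add]
  rw [runWeight_shift, runWeight, runWeight, h1, runStarts_consRun g hl,
    Finset.sum_insert (notMem_shift_self g l _), sum_shift]
  ring

lemma consRun_injective {g l g' l' : ℕ} {A A' : Finset ℕ} (hl : 0 < l) (hl' : 0 < l')
    (h : consRun g l A = consRun g' l' A') : g = g' ∧ l = l' ∧ A = A' := by
  have H : ∀ b, ((g ≤ b ∧ b < g + l) ∨ ∃ a ∈ A, a + (g + l + 1) = b) ↔
      ((g' ≤ b ∧ b < g' + l') ∨ ∃ a ∈ A', a + (g' + l' + 1) = b) := fun b => by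
    rw [← mem_consRun, h, mem_consRun]
  have hg : g = g' := by
    have h1 := (H g).1 (Or.inl ⟨le_rfl, by omega⟩)
    have h2 := (H g').2 (Or.inl ⟨le_rfl, by omega⟩)
    rcases h1 with h1 | ⟨a, -, h1⟩ <;> rcases h2 with h2 | ⟨b, -, h2⟩ <;> omega
  subst hg
  have hll : l = l' := by
    rcases lt_trichotomy l l' with hlt | heq | hlt
    · rcases (H (g + l)).2 (Or.inl ⟨by omega, by omega⟩) with h1 | ⟨a, -, h1⟩ <;> omega
    · exact heq
    · rcases (H (g + l')).1 (Or.inl ⟨by omega, by omega⟩) with h1 | ⟨a, -, h1⟩ <;> omega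
  subst hll
  refine ⟨rfl, rfl, Finset.ext fun a => ⟨fun ha => ?_, fun ha => ?_⟩⟩
  · rcases (H (a + (g + l + 1))).1 (Or.inr ⟨a, ha, rfl⟩) with h1 | ⟨b, hb, h1⟩
    · omega
    · rwa [show a = b by omega]
  · rcases (H (a + (g + l + 1))).2 (Or.inr ⟨a, ha, rfl⟩) with h1 | ⟨b, hb, h1⟩
    · omega
    · rwa [show a = b by omega]

lemma exists_consRun {S : Finset ℕ} (hS : S.Nonempty) :
    ∃ g l A, 0 < l ∧ S = consRun g l A := by
  classical
  set g := S.min' hS with hg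
  have hgS : g ∈ S := S.min'_mem hS
  have hmin : ∀ b ∈ S, g ≤ b := fun b hb => S.min'_le b hb
  have hex : ∃ l, g + l ∉ S := by
    obtain ⟨b, hb⟩ := Infinite.exists_notMem_finset (S ∪ Finset.range g)
    simp only [Finset.mem_union, Finset.mem_range, not_or, not_lt] at hb
    exact ⟨b - g, by rw [Nat.add_sub_cancel' hb.2]; exact hb.1⟩
  set l := Nat.find hex with hl
  have hlS : g + l ∉ S := Nat.find_spec hex
  have hlt : ∀ k < l, g + k ∈ S := fun k hk => not_not.1 (Nat.find_min hex hk)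
  refine ⟨g, l, (S.filter (g + l < ·)).image (· - (g + l + 1)), ?_, ?_⟩
  · rcases Nat.eq_zero_or_pos l with h0 | h0
    · rw [h0] at hlS
      exact absurd hgS hlS
    · exact h0
  · ext b
    simp only [mem_consRun, Finset.mem_image, Finset.mem_filter]
    constructor
    · intro hb
      rcases lt_trichotomy b (g + l) with h | h | h
      · exact Or.inl ⟨hmin b hb, h⟩
      · exact absurd (h ▸ hb) hlS
      · exact Or.inr ⟨_, ⟨b, ⟨hb, h⟩, rfl⟩, by omega⟩
    · rintro (⟨h1, h2⟩ | ⟨a, ⟨c, ⟨hc, h⟩, rfl⟩, h3⟩)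
      · have := hlt (b - g) (by omega)
        rwa [Nat.add_sub_cancel' h1] at this
      · rwa [show b = c by omega]

/-- The finite set whose runs have lengths `a 0, a 1, …` from left to right, the first one starting
at `g 0` and the later ones separated from their predecessors by `g 1 + 1, g 2 + 1, …` sites. -/
def ofRuns : {K : ℕ} → (Fin K → ℕ+) → (Fin K → ℕ) → Finset ℕ
  | 0, _, _ => ∅
  | _ + 1, a, g => consRun (g 0) (a 0) (ofRuns (Fin.tail a) (Fin.tail g))

lemma card_ofRuns {K : ℕ} (a : Fin K → ℕ+) (g : Fin K → ℕ) : (ofRuns a g).card = total a := by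
  induction K with
  | zero => simp [ofRuns, total]
  | succ K ih => rw [ofRuns, card_consRun, ih, total, total, Fin.sum_univ_succ]; rfl

lemma card_runStarts_ofRuns {K : ℕ} (a : Fin K → ℕ+) (g : Fin K → ℕ) :
    (runStarts (ofRuns a g)).card = K := by
  induction K with
  | zero => simp [ofRuns, runStarts]
  | succ K ih => rw [ofRuns, card_runStarts_consRun _ (a 0).pos, ih]

lemma ofRuns_injective {K : ℕ} {a a' : Fin K → ℕ+} {g g' : Fin K → ℕ}
    (h : ofRuns a g = ofRuns a' g') : a = a' ∧ g = g' := by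
  induction K with
  | zero => exact ⟨Subsingleton.elim _ _, Subsingleton.elim _ _⟩
  | succ K ih =>
    obtain ⟨h1, h2, h3⟩ := consRun_injective (a 0).pos (a' 0).pos h
    obtain ⟨h4, h5⟩ := ih h3
    refine ⟨?_, ?_⟩
    · rw [← Fin.cons_self_tail a, ← Fin.cons_self_tail a', h4, PNat.eq h2]
    · rw [← Fin.cons_self_tail g, ← Fin.cons_self_tail g', h5, h1]

lemma exists_ofRuns (S : Finset ℕ) :
    ∃ (K : ℕ) (a : Fin K → ℕ+) (g : Fin K → ℕ), S = ofRuns a g := by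
  induction hn : S.card using Nat.strong_induction_on generalizing S with
  | _ n ih =>
    rcases S.eq_empty_or_nonempty with rfl | hS
    · exact ⟨0, Fin.elim0, Fin.elim0, rfl⟩
    · obtain ⟨g, l, A, hl, rfl⟩ := exists_consRun hS
      rw [card_consRun] at hn
      obtain ⟨K, a, g', rfl⟩ := ih _ (by omega) A rfl
      exact ⟨K + 1, Fin.cons ⟨l, hl⟩ a, Fin.cons g g', rfl⟩

/-! ### Summation over the gaps -/

lemma tailSum_succ {K : ℕ} (a : Fin (K + 1) → ℕ+) (j : Fin K) :
    tailSum a j.succ = tailSum (Fin.tail a) j := by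
  simp only [tailSum, Fin.tail]
  rw [← Fin.map_succEmb_Ici, Finset.sum_map]
  rfl

lemma tailSum_zero {K : ℕ} (a : Fin (K + 1) → ℕ+) : tailSum a 0 = total a := by
  simp [tailSum, total, ← bot_eq_zero]

lemma pred_succ {K : ℕ} (a₀ : ℤ) (a : Fin (K + 1) → ℕ+) (j : Fin K) :
    pred a₀ a j.succ = pred (a 0 : ℕ) (Fin.tail a) j := by
  cases K with
  | zero => exact j.elim0
  | succ K =>
    refine Fin.cases ?_ (fun i => ?_) j
    · simp [pred]
    · simp [pred, Fin.tail]

lemma runProd_succ (Q x : ℝ) (a₀ : ℤ) {K : ℕ} (a : Fin (K + 1) → ℕ+) :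
    runProd Q x a₀ a =
      Q ^ ((a 0 : ℕ) * ((a 0 : ℕ) - 1) / 2) * (x ^ (K + 1) * Q ^ total a) ^ (a₀ + 1) /
        (1 - x ^ (K + 1) * Q ^ total a) * runProd Q x (a 0 : ℕ) (Fin.tail a) := by
  rw [runProd, Fin.prod_univ_succ, tailSum_zero, runProd]
  congr 1
  refine Finset.prod_congr rfl fun j _ => ?_
  rw [tailSum_succ, pred_succ, Fin.val_succ, Nat.add_sub_add_right]
  rfl

/-- Raising `a₀` by one moves the whole configuration by one site. -/
lemma runProd_zero (Q x : ℝ) {K : ℕ} (hK : 0 < K) (a : Fin K → ℕ+) :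
    runProd Q x 0 a = x ^ K * Q ^ total a * runProd Q x (-1) a := by
  obtain ⟨K, rfl⟩ := Nat.exists_eq_succ_of_ne_zero hK.ne'
  rw [runProd_succ, runProd_succ]
  simp
  ring

lemma le_total {K : ℕ} (a : Fin K → ℕ+) : K ≤ total a := by
  simpa [total] using Finset.sum_le_sum fun (j : Fin K) (_ : j ∈ Finset.univ) =>
    show 1 ≤ (a j : ℕ) from (a j).pos

lemma pow_mul_pow_lt_one {Q x : ℝ} (hQ : 0 ≤ Q) (hQ1 : Q ≤ 1) (hx : 0 ≤ x) (hxQ : x * Q < 1)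
    {K D : ℕ} (hK : 0 < K) (hKD : K ≤ D) : x ^ K * Q ^ D < 1 :=
  calc x ^ K * Q ^ D ≤ x ^ K * Q ^ K := by gcongr ?_ * ?_; exact pow_le_pow_of_le_one hQ hQ1 hKD
    _ = (x * Q) ^ K := by rw [mul_pow]
    _ < 1 := pow_lt_one₀ (by positivity) hxQ hK.ne'

lemma runWeight_nonneg {Q x : ℝ} (hQ : 0 ≤ Q) (hx : 0 ≤ x) (S : Finset ℕ) :
    0 ≤ runWeight Q x S := by
  unfold runWeight; positivity

/-- For prescribed run lengths, summing over the gaps gives one geometric series per run. -/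
lemma hasSum_runWeight_shift {Q x : ℝ} (hQ : 0 ≤ Q) (hQ1 : Q ≤ 1) (hx : 0 ≤ x) (hxQ : x * Q < 1)
    {K : ℕ} (a : Fin K → ℕ+) (c : ℕ) :
    HasSum (fun g : Fin K → ℕ => runWeight Q x (shift c (ofRuns a g)))
      (runProd Q x ((c : ℤ) - 1) a) := by
  induction K generalizing c with
  | zero =>
    convert hasSum_unique (fun g : Fin 0 → ℕ => runWeight Q x (shift c (ofRuns a g))) using 1
    simp [ofRuns, runProd, runWeight, shift, runStarts]
  | succ K ih =>
    set ρ := x ^ (K + 1) * Q ^ total a with hρ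
    have hρ0 : 0 ≤ ρ := by positivity
    have hρ1 : ρ < 1 := pow_mul_pow_lt_one hQ hQ1 hx hxQ K.succ_pos (le_total a)
    have hgeo := (hasSum_geometric_of_lt_one hρ0 hρ1).mul_left
      (Q ^ ((a 0 : ℕ) * ((a 0 : ℕ) - 1) / 2) * ρ ^ c)
    have hrest := ih (Fin.tail a) ((a 0 : ℕ) + 1)
    have hmul := hgeo.mul hrest (hgeo.summable.mul_of_nonneg hrest.summable
      (fun g => by positivity) (fun g => runWeight_nonneg hQ hx _))
    rw [← (Fin.consEquiv fun _ : Fin (K + 1) => ℕ).hasSum_iff]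
    convert! hmul using 1
    · ext ⟨g, g'⟩
      have htot : (a 0 : ℕ) + total (Fin.tail a) = total a := by
        rw [total, total, Fin.sum_univ_succ]; rfl
      simp only [Function.comp, Fin.consEquiv, Equiv.coe_fn_mk, ofRuns, Fin.cons_zero,
        Fin.tail_cons]
      rw [runWeight_shift, card_runStarts_consRun _ (a 0).pos, card_consRun,
        runWeight_consRun _ _ _ (a 0).pos, card_ofRuns, card_runStarts_ofRuns, htot, ← hρ]
      ring
    · rw [runProd_succ, ← hρ]
      push_cast
      simp [div_eq_mul_inv]

lemma hasSum_runWeight {Q x : ℝ} (hQ : 0 ≤ Q) (hQ1 : Q ≤ 1) (hx : 0 ≤ x) (hxQ : x * Q < 1)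
    {K : ℕ} (a : Fin K → ℕ+) :
    HasSum (fun g : Fin K → ℕ => runWeight Q x (ofRuns a g)) (runProd Q x (-1) a) := by
  simpa [runWeight_shift] using hasSum_runWeight_shift hQ hQ1 hx hxQ a 0

/-! ### Weights of pairs of finite sets -/

/-- The weight of a pair `(S, T)` of finite sets of equal size, without the correction for the runs
that start at `0`; it is `0` if the sizes differ. -/
noncomputable def freeWeight (n : ℤ) (Q y : ℝ) (P : Finset ℕ × Finset ℕ) : ℝ :=
  if P.2.card = P.1.card then
    y ^ (n * ((runStarts P.1).card + (runStarts P.2).card)) * Q ^ P.1.card *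
      (runWeight Q y⁻¹ P.1 * runWeight Q y P.2)
  else 0

/-- The weight of the Maya diagram whose particles on the negative side are the `-b - 1`, `b ∈ S`,
and whose holes on the nonnegative side are the `a ∈ T`, where `P = (S, T)`. -/
noncomputable def mayaWeight (n : ℤ) (Q y : ℝ) (P : Finset ℕ × Finset ℕ) : ℝ :=
  freeWeight n Q y P * if 0 ∈ P.1 ∨ 0 ∈ P.2 then y ^ (-n) else 1

/-- The factor by which the weight of `(S, T)` changes when both sets are moved by one site. -/
noncomputable def originFactor (Q y : ℝ) (P : Finset ℕ × Finset ℕ) : ℝ :=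
  y ^ (((runStarts P.2).card : ℤ) - (runStarts P.1).card) * Q ^ P.1.card * Q ^ P.2.card

lemma freeWeight_nonneg (n : ℤ) {Q y : ℝ} (hQ : 0 ≤ Q) (hy : 0 ≤ y) (P : Finset ℕ × Finset ℕ) :
    0 ≤ freeWeight n Q y P := by
  unfold freeWeight runWeight
  split_ifs <;> positivity

lemma freeWeight_shift (n : ℤ) {Q y : ℝ} (hy : 0 < y) (P : Finset ℕ × Finset ℕ) :
    freeWeight n Q y (shift 1 P.1, shift 1 P.2) = freeWeight n Q y P * originFactor Q y P := by
  unfold freeWeight originFactor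
  simp only [card_shift, runStarts_shift, runWeight_shift, pow_one]
  split_ifs with h
  · rw [zpow_sub₀ hy.ne']
    simp only [zpow_natCast, inv_pow]
    ring
  · simp

lemma runStarts_subset (S : Finset ℕ) : runStarts S ⊆ S := Finset.filter_subset _ _

lemma zpow_le_inv_pow {y : ℝ} (hy : 0 < y) (hy1 : y ≤ 1) (n : ℤ) (k m : ℕ) (hkm : k ≤ m) :
    y ^ (n * (k : ℤ)) ≤ (y⁻¹ ^ n.natAbs) ^ m := by
  rw [← pow_mul, ← zpow_natCast, inv_zpow', Nat.cast_mul]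
  refine zpow_le_zpow_right_of_le_one₀ hy hy1 ?_
  have h1 : -(n.natAbs : ℤ) ≤ n := by omega
  have h2 : (k : ℤ) ≤ m := by exact_mod_cast hkm
  nlinarith [n.natAbs.cast_nonneg (α := ℤ)]

/-- Each element `b` of `S` contributes at most a constant times `(Q / y) ^ b`. -/
lemma zpow_mul_runWeight_le {Q x y : ℝ} (hQ : 0 ≤ Q) (hy : 0 < y) (hy1 : y ≤ 1) (hx : 0 ≤ x)
    (hxy : x ≤ y⁻¹) (n : ℤ) (S : Finset ℕ) :
    y ^ (n * ((runStarts S).card : ℤ)) * runWeight Q x S ≤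
      ∏ b ∈ S, y⁻¹ ^ n.natAbs * (Q * y⁻¹) ^ b := by
  have hy1' : 1 ≤ y⁻¹ := (one_le_inv₀ hy).2 hy1
  have h1 : x ^ (∑ b ∈ runStarts S, b) ≤ y⁻¹ ^ (∑ b ∈ S, b) :=
    (pow_le_pow_left₀ hx hxy _).trans
      (pow_le_pow_right₀ hy1' (Finset.sum_le_sum_of_subset (runStarts_subset S)))
  rw [Finset.prod_mul_distrib, Finset.prod_const, Finset.prod_pow_eq_pow_sum, mul_pow, runWeight]
  have h2 := zpow_le_inv_pow hy hy1 n _ _ (Finset.card_le_card (runStarts_subset S))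
  gcongr

lemma summable_freeWeight (n : ℤ) {Q y : ℝ} (hQ₀ : 0 < Q) (hQy : Q < y) (hy : y ≤ 1) :
    Summable (freeWeight n Q y) := by
  have hy0 : 0 < y := hQ₀.trans hQy
  have hy1' : 1 ≤ y⁻¹ := (one_le_inv₀ hy0).2 hy
  have hq : Q * y⁻¹ < 1 := by rw [← div_eq_mul_inv]; exact (div_lt_one hy0).2 hQy
  have hs : Summable fun S : Finset ℕ => ∏ b ∈ S, y⁻¹ ^ n.natAbs * (Q * y⁻¹) ^ b :=
    summable_finsetProd_of_summable_nonneg (fun b => by positivity)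
      ((summable_geometric_of_lt_one (by positivity) hq).mul_left _)
  have hnn : ∀ S : Finset ℕ, 0 ≤ ∏ b ∈ S, y⁻¹ ^ n.natAbs * (Q * y⁻¹) ^ b := fun S => by positivity
  refine (hs.mul_of_nonneg hs hnn hnn).of_nonneg_of_le
    (freeWeight_nonneg n hQ₀.le hy0.le) fun P => ?_
  unfold freeWeight
  split_ifs with h
  · have h1 := zpow_mul_runWeight_le hQ₀.le hy0 hy (inv_nonneg.2 hy0.le) le_rfl n P.1
    have h2 := zpow_mul_runWeight_le hQ₀.le hy0 hy hy0.le (hy.trans hy1') n P.2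
    have h3 : Q ^ P.1.card ≤ 1 := pow_le_one₀ hQ₀.le (hQy.le.trans hy)
    have hw1 := runWeight_nonneg hQ₀.le (inv_nonneg.2 hy0.le) P.1
    have hw2 := runWeight_nonneg hQ₀.le hy0.le P.2
    rw [mul_add, zpow_add₀ hy0.ne']
    calc _ = Q ^ P.1.card * ((y ^ (n * ((runStarts P.1).card : ℤ)) * runWeight Q y⁻¹ P.1) *
            (y ^ (n * ((runStarts P.2).card : ℤ)) * runWeight Q y P.2)) := by ring
      _ ≤ 1 * _ := mul_le_mul h3 (mul_le_mul h1 h2 (by positivity) (hnn _)) (by positivity)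
            zero_le_one
      _ = _ := one_mul _
  · exact mul_nonneg (hnn _) (hnn _)

lemma shift_injective (c : ℕ) : Function.Injective (shift c) := Finset.map_injective _

lemma exists_shift_one {S : Finset ℕ} (hS : 0 ∉ S) : ∃ A, shift 1 A = S := by
  refine ⟨S.image (· - 1), Finset.ext fun b => ?_⟩
  simp only [mem_shift, Finset.mem_image]
  constructor
  · rintro ⟨_, ⟨c, hc, rfl⟩, rfl⟩
    have : c ≠ 0 := fun h => hS (h ▸ hc)
    rwa [Nat.sub_add_cancel (by omega)]
  · intro hb
    have : b ≠ 0 := fun h => hS (h ▸ hb)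
    exact ⟨b - 1, ⟨b, hb, rfl⟩, by omega⟩

/-- The pairs with `0 ∉ S` and `0 ∉ T` are the translates by one of all pairs, and translation
multiplies the weight by `originFactor`. -/
lemma hasSum_mayaWeight (n : ℤ) {Q y : ℝ} (hQ₀ : 0 < Q) (hQy : Q < y) (hy : y ≤ 1) :
    ∃ s, HasSum (mayaWeight n Q y) s ∧
      HasSum (fun P => freeWeight n Q y P *
        (y ^ (-n) + (1 - y ^ (-n)) * originFactor Q y P)) s := by
  have hy0 : 0 < y := hQ₀.trans hQy
  have hU := summable_freeWeight n hQ₀ hQy hy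
  set σ : Finset ℕ × Finset ℕ → Finset ℕ × Finset ℕ := fun P => (shift 1 P.1, shift 1 P.2) with hσ
  have hσi : Function.Injective σ := fun P P' h =>
    Prod.ext (shift_injective 1 (Prod.ext_iff.1 h).1) (shift_injective 1 (Prod.ext_iff.1 h).2)
  have hX : HasSum (fun P => freeWeight n Q y P * originFactor Q y P)
      (∑' P, freeWeight n Q y (σ P)) :=
    (hU.comp_injective hσi).hasSum.congr_fun fun P => (freeWeight_shift n hy0 P).symm
  have hI : HasSum (fun P : Finset ℕ × Finset ℕ =>
      if 0 ∈ P.1 ∨ 0 ∈ P.2 then 0 else freeWeight n Q y P) (∑' P, freeWeight n Q y (σ P)) := by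
    rw [← hσi.hasSum_iff]
    · convert! (hU.comp_injective hσi).hasSum using 1
      ext P
      simp [hσ, mem_shift]
    · intro P hP
      rw [if_pos]
      by_contra! h
      obtain ⟨A, hA⟩ := exists_shift_one h.1
      obtain ⟨B, hB⟩ := exists_shift_one h.2
      exact hP ⟨(A, B), Prod.ext hA hB⟩
  refine ⟨_, (hU.hasSum.mul_left (y ^ (-n))).add (hI.mul_left (1 - y ^ (-n))) |>.congr_fun ?_,
    (hU.hasSum.mul_left (y ^ (-n))).add (hX.mul_left (1 - y ^ (-n))) |>.congr_fun ?_⟩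
  · intro P
    unfold mayaWeight
    split_ifs <;> ring
  · intro P
    ring

/-! ### Resummation over the run lengths -/

/-- The pair of finite sets with prescribed run lengths and gaps. -/
def ofRunIndex (t : Σ t : RunIndex, (Fin t.1.1 → ℕ) × (Fin t.1.2 → ℕ)) : Finset ℕ × Finset ℕ :=
  (ofRuns t.1.2.1 t.2.1, ofRuns t.1.2.2 t.2.2)

lemma ofRunIndex_injective : Function.Injective ofRunIndex := by
  rintro ⟨⟨⟨L, R⟩, l, m⟩, g, h⟩ ⟨⟨⟨L', R'⟩, l', m'⟩, g', h'⟩ heq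
  obtain ⟨h1, h2⟩ := Prod.ext_iff.1 heq
  simp only [ofRunIndex] at h1 h2 l m g h l' m' g' h'
  obtain rfl : L = L' := PNat.eq <| by
    rw [← card_runStarts_ofRuns l g, h1, card_runStarts_ofRuns]
  obtain rfl : R = R' := PNat.eq <| by
    rw [← card_runStarts_ofRuns m h, h2, card_runStarts_ofRuns]
  obtain ⟨rfl, rfl⟩ := ofRuns_injective h1
  obtain ⟨rfl, rfl⟩ := ofRuns_injective h2
  rfl

lemma mem_range_ofRunIndex {P : Finset ℕ × Finset ℕ} (h1 : P.1.Nonempty) (h2 : P.2.Nonempty) :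
    P ∈ Set.range ofRunIndex := by
  obtain ⟨S, T⟩ := P
  obtain ⟨L, l, g, rfl⟩ := exists_ofRuns S
  obtain ⟨R, m, h, rfl⟩ := exists_ofRuns T
  have hL : 0 < L := Nat.pos_of_ne_zero fun h0 => by subst h0; simp [ofRuns] at h1
  have hR : 0 < R := Nat.pos_of_ne_zero fun h0 => by subst h0; simp [ofRuns] at h2
  exact ⟨⟨⟨(⟨L, hL⟩, ⟨R, hR⟩), (l, m)⟩, (g, h)⟩, rfl⟩

/-- For prescribed run lengths, the sum over all gaps is the summand of the multiple sum. -/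
lemma hasSum_runTerm (n : ℤ) {Q y : ℝ} (hQ₀ : 0 < Q) (hQy : Q < y) (hy : y ≤ 1) {L R : ℕ}
    (hR : 0 < R) (l : Fin L → ℕ+) (m : Fin R → ℕ+) :
    HasSum (fun g : (Fin L → ℕ) × (Fin R → ℕ) =>
      freeWeight n Q y (ofRuns l g.1, ofRuns m g.2) *
        (y ^ (-n) + (1 - y ^ (-n)) * originFactor Q y (ofRuns l g.1, ofRuns m g.2)))
      (runTerm n Q y L R l m) := by
  have hy0 : 0 < y := hQ₀.trans hQy
  have hQ1 : Q < 1 := hQy.trans_le hy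
  have hy0' : 0 ≤ y⁻¹ := inv_nonneg.2 hy0.le
  have hyQ : y⁻¹ * Q < 1 := by rw [mul_comm, ← div_eq_mul_inv]; exact (div_lt_one hy0).2 hQy
  have hS := hasSum_runWeight hQ₀.le hQ1.le hy0' hyQ l
  have hT := hasSum_runWeight hQ₀.le hQ1.le hy0.le
    (mul_lt_one_of_nonneg_of_lt_one_right hy hQ₀.le hQ1) m
  have hST := hS.mul hT (hS.summable.mul_of_nonneg hT.summable
    (fun g => runWeight_nonneg hQ₀.le hy0' _) (fun g => runWeight_nonneg hQ₀.le hy0.le _))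
  simp only [freeWeight, originFactor, card_ofRuns, card_runStarts_ofRuns]
  rw [runTerm, runProd_zero Q y hR m]
  by_cases h : total m = total l
  · simp only [if_pos h]
    have hcancel : ∀ a b A B q X : ℝ, b ≠ 0 →
        a / b * 1 * A * (b * q * B) * X = a * q * X * (A * B) := fun a b A B q X hb => by
      field_simp
    rw [show n * (L : ℤ) + (n - 1) * (R : ℤ) = n * (L + R : ℤ) - (R : ℤ) by ring,
      zpow_sub₀ hy0.ne' (n * (L + R : ℤ)), zpow_natCast,
      hcancel _ _ _ _ _ _ (pow_ne_zero R hy0.ne'), h]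
    refine (hST.mul_left _).congr_fun fun g => ?_
    ring
  · simp only [if_neg h, mul_zero, zero_mul]
    exact hasSum_zero

/-- The pair of empty sets accounts for the summand `1` of `Zn`. -/
lemma hasSum_runFamily (n : ℤ) {Q y : ℝ} (hQ₀ : 0 < Q) (hQy : Q < y) (hy : y ≤ 1) :
    ∃ r, HasSum (runFamily n Q y) r ∧ HasSum (mayaWeight n Q y) (1 + r) := by
  classical
  obtain ⟨s, hs, hs'⟩ := hasSum_mayaWeight n hQ₀ hQy hy
  refine ⟨s - 1, ?_, by simpa using hs⟩
  have h0 := hs'.update (∅, ∅) 0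
  have hE : freeWeight n Q y (∅, ∅) *
      (y ^ (-n) + (1 - y ^ (-n)) * originFactor Q y (∅, ∅)) = 1 := by
    simp [freeWeight, originFactor, runWeight, runStarts]
  rw [hE, ← ofRunIndex_injective.hasSum_iff] at h0
  · rw [show s - 1 = 0 - 1 + s by ring]
    refine h0.sigma fun t => (hasSum_runTerm n hQ₀ hQy hy t.1.2.pos t.2.1 t.2.2).congr_fun fun g => ?_
    refine Function.update_of_ne (fun h => ?_) _ _
    have := card_runStarts_ofRuns t.2.1 g.1
    rw [show ofRuns t.2.1 g.1 = ∅ from (Prod.ext_iff.1 h).1] at this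
    simp [runStarts] at this
    exact t.1.1.ne_zero this.symm
  · -- pairs of equal size outside the range are empty
    intro P hP
    by_cases hP0 : P = (∅, ∅)
    · rw [hP0, Function.update_self]
    · rw [Function.update_of_ne hP0, freeWeight, if_neg, zero_mul]
      intro hc
      rcases P.1.eq_empty_or_nonempty with h1 | h1
      · rw [h1, Finset.card_empty, Finset.card_eq_zero] at hc
        exact hP0 (Prod.ext h1 hc)
      · exact hP (mem_range_ofRunIndex h1 (Finset.card_pos.1 (hc ▸ Finset.card_pos.2 h1)))

/-! ### Maya diagrams -/

/-- The value of a configuration at the site `-(k + 1)`. -/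
def occ (z : NegInt → ℕ) (k : ℕ) : ℕ := z (site k.succPNat)

/-- `q` lists the particles of the Maya diagram of `ω` from left to right: `ω k` is the number of
holes between the particles `k` and `k + 1`, and from index `N` on the particles are those of the
ground state `ℕ`. -/
structure IsProfile (ω : ℕ → ℕ) (q : ℕ → ℤ) (N : ℕ) : Prop where
  eq_self : ∀ k, N ≤ k → q k = k
  succ : ∀ k, q (k + 1) = q k + 1 + ω k

/-- `P = (S, T)` consists of the particles `-b - 1 < 0`, `b ∈ S`, and of the holes `a ≥ 0`, `a ∈ T`,
of the Maya diagram with particle positions `q`. -/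
structure IsMaya (q : ℕ → ℤ) (P : Finset ℕ × Finset ℕ) : Prop where
  mem_fst : ∀ b, b ∈ P.1 ↔ ∃ k, q k = -(b : ℤ) - 1
  mem_snd : ∀ a, a ∈ P.2 ↔ ∀ k, q k ≠ a

lemma IsProfile.strictMono {ω : ℕ → ℕ} {q : ℕ → ℤ} {N : ℕ} (h : IsProfile ω q N) : StrictMono q :=
  strictMono_nat_of_lt_succ fun k => by rw [h.succ]; omega

lemma IsProfile.unique {ω : ℕ → ℕ} {q q' : ℕ → ℤ} {N N' : ℕ} (h : IsProfile ω q N)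
    (h' : IsProfile ω q' N') : q = q' := by
  have hd : ∀ k, q k - q' k = q 0 - q' 0 := fun k => by
    induction k with
    | zero => rfl
    | succ k ih => rw [h.succ, h'.succ]; linarith
  have h0 := hd (max N N')
  rw [h.eq_self _ (le_max_left _ _), h'.eq_self _ (le_max_right _ _)] at h0
  funext k
  linarith [hd k]

lemma IsMaya.unique {q : ℕ → ℤ} {P P' : Finset ℕ × Finset ℕ} (h : IsMaya q P) (h' : IsMaya q P') :
    P = P' :=
  Prod.ext (Finset.ext fun b => by rw [h.mem_fst, h'.mem_fst])
    (Finset.ext fun a => by rw [h.mem_snd, h'.mem_snd])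

lemma IsMaya.exists_eq_iff {q : ℕ → ℤ} {P : Finset ℕ × Finset ℕ} (h : IsMaya q P) (c : ℤ) :
    (∃ k, q k = c) ↔ if c < 0 then (-c - 1).toNat ∈ P.1 else c.toNat ∉ P.2 := by
  split_ifs with hc
  · rw [h.mem_fst, show -((-c - 1).toNat : ℤ) - 1 = c by omega]
  · rw [h.mem_snd, show (c.toNat : ℤ) = c by omega]
    push Not
    rfl

lemma IsProfile.exists_isMaya {ω : ℕ → ℕ} {q : ℕ → ℤ} {N : ℕ} (h : IsProfile ω q N) :
    ∃ P, IsMaya q P := by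
  classical
  refine ⟨(((Finset.range N).filter (q · < 0)).image fun k => (-q k - 1).toNat,
    (Finset.range N).filter fun a => ∀ k, q k ≠ a), ⟨fun b => ?_, fun a => ?_⟩⟩
  · simp only [Finset.mem_image, Finset.mem_filter, Finset.mem_range]
    constructor
    · rintro ⟨k, ⟨-, hk⟩, rfl⟩
      exact ⟨k, by omega⟩
    · rintro ⟨k, hk⟩
      refine ⟨k, ⟨?_, by omega⟩, by omega⟩
      by_contra! hN
      have := h.eq_self k hN
      omega
  · simp only [Finset.mem_filter, Finset.mem_range, and_iff_right_iff_imp]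
    intro ha
    by_contra! hN
    exact ha a (h.eq_self a hN)

/-- The particles before index `N`, together with the holes `T`, are the sites `0, …, N - 1` together
with the particles on the negative side. -/
lemma sum_isMaya {ω : ℕ → ℕ} {q : ℕ → ℤ} {N : ℕ} (h : IsProfile ω q N) {S T : Finset ℕ}
    (hP : IsMaya q (S, T)) (φ : ℤ → ℤ) :
    ∑ k ∈ Finset.range N, φ (q k) + ∑ a ∈ T, φ a =
      ∑ b ∈ S, φ (-(b : ℤ) - 1) + ∑ k ∈ Finset.range N, φ k := by
  classical
  have hT : T ⊆ Finset.range N := fun a ha => by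
    rw [Finset.mem_range]
    by_contra! hN
    exact (hP.mem_snd a).1 ha a (h.eq_self a hN)
  have hlt : ∀ k, q k < N ↔ k < N := fun k => by
    rw [← h.strictMono.lt_iff_lt (a := k) (b := N), h.eq_self N le_rfl]
  have himg : (Finset.range N).image q =
      S.image (fun b : ℕ => -(b : ℤ) - 1) ∪ (Finset.range N \ T).image (fun a : ℕ => (a : ℤ)) := by
    ext c
    simp only [Finset.mem_union, Finset.mem_image, Finset.mem_sdiff, Finset.mem_range]
    constructor
    · rintro ⟨k, hk, rfl⟩
      rcases lt_or_ge (q k) 0 with h0 | h0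
      · exact Or.inl ⟨(-q k - 1).toNat, (hP.mem_fst _).2 ⟨k, by omega⟩, by omega⟩
      · have := (hlt k).2 hk
        refine Or.inr ⟨(q k).toNat, ⟨by omega, fun hm => ?_⟩, by omega⟩
        exact (hP.mem_snd _).1 hm k (by omega)
    · rintro (⟨b, hb, rfl⟩ | ⟨a, ⟨ha, haT⟩, rfl⟩)
      · obtain ⟨k, hk⟩ := (hP.mem_fst b).1 hb
        exact ⟨k, (hlt k).1 (by omega), hk⟩
      · have := mt (hP.mem_snd a).2 haT
        push Not at this
        obtain ⟨k, hk⟩ := this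
        exact ⟨k, (hlt k).1 (by omega), hk⟩
  have hdis : Disjoint (S.image (fun b : ℕ => -(b : ℤ) - 1))
      ((Finset.range N \ T).image (fun a : ℕ => (a : ℤ))) := by
    rw [Finset.disjoint_left]
    intro c hc hc'
    obtain ⟨b, -, rfl⟩ := Finset.mem_image.1 hc
    obtain ⟨a, -, ha⟩ := Finset.mem_image.1 hc'
    omega
  have hsum : ∑ k ∈ Finset.range N, φ (q k) = ∑ c ∈ (Finset.range N).image q, φ c :=
    (Finset.sum_image (h.strictMono.injective.injOn)).symm
  rw [hsum, himg, Finset.sum_union hdis, Finset.sum_image (fun a _ b _ hab => by simpa using hab),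
    Finset.sum_image (fun a _ b _ hab => by simpa using hab), add_assoc,
    Finset.sum_sdiff hT (f := fun a : ℕ => φ a)]

lemma card_isMaya {ω : ℕ → ℕ} {q : ℕ → ℤ} {N : ℕ} (h : IsProfile ω q N) {S T : Finset ℕ}
    (hP : IsMaya q (S, T)) : T.card = S.card := by
  have := sum_isMaya h hP fun _ => 1
  simp at this
  omega

/-! ### The weight of a configuration in terms of its Maya diagram -/

/-- Summation by parts. -/
lemma sum_succ_mul_profile {ω : ℕ → ℕ} {q : ℕ → ℤ} {N : ℕ} (h : IsProfile ω q N) (M : ℕ) :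
    ∑ k ∈ Finset.range M, ((k : ℤ) + 1) * ω k =
      M * (q M - M) - ∑ k ∈ Finset.range M, q k + ∑ k ∈ Finset.range M, (k : ℤ) := by
  induction M with
  | zero => simp
  | succ M ih =>
    rw [Finset.sum_range_succ, Finset.sum_range_succ, Finset.sum_range_succ, ih, h.succ]
    push_cast
    ring

/-- The energy `∑ i * z_{-i}` in terms of the displaced particles and holes. -/
lemma energy_isMaya {ω : ℕ → ℕ} {q : ℕ → ℤ} {N : ℕ} (h : IsProfile ω q N) {S T : Finset ℕ}
    (hP : IsMaya q (S, T)) :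
    ∑ k ∈ Finset.range N, (k + 1) * ω k = S.card + (∑ b ∈ S, b + ∑ a ∈ T, a) := by
  have h1 := sum_isMaya h hP id
  have h2 := sum_succ_mul_profile h N
  rw [h.eq_self N le_rfl] at h2
  simp only [id, Finset.sum_sub_distrib, Finset.sum_neg_distrib, Finset.sum_const,
    nsmul_eq_mul, mul_one] at h1
  zify
  linarith

/-- The elements of `T` that are not run starts are the successors in `T` of elements of `T`. -/
lemma sum_runStarts_add (T : Finset ℕ) (f : ℕ → ℤ) :
    ∑ a ∈ runStarts T, f a + ∑ a ∈ T, (if a + 1 ∈ T then f (a + 1) else 0) = ∑ a ∈ T, f a := by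
  rw [runStarts, ← Finset.sum_filter_add_sum_filter_not T (fun b => ∀ c ∈ T, c + 1 ≠ b) f,
    ← Finset.sum_filter]
  congr 1
  refine (Finset.sum_map _ (addRightEmbedding 1) f).symm.trans ?_
  refine Finset.sum_congr (Finset.ext fun b => ?_) fun _ _ => rfl
  simp only [Finset.mem_map, Finset.mem_filter, addRightEmbedding_apply]
  push Not
  constructor
  · rintro ⟨a, ⟨ha, ha'⟩, rfl⟩
    exact ⟨ha', a, ha, rfl⟩
  · rintro ⟨hb, a, ha, rfl⟩
    exact ⟨a, ⟨ha, hb⟩, rfl⟩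

/-- The exponent of `y`: the particles followed by a hole are the right ends of the particle
blocks. On the negative side these are the run starts of `S`, on the nonnegative side they precede
the run starts of `T`, and both descriptions meet at the origin. -/
lemma exponent_isMaya {ω : ℕ → ℕ} {q : ℕ → ℤ} {N : ℕ} (h : IsProfile ω q N) {S T : Finset ℕ}
    (hP : IsMaya q (S, T)) (n : ℤ) :
    ∑ k ∈ Finset.range N, (if 0 < ω k then n + 1 + q k else 0) =
      ∑ b ∈ runStarts S, (n - b) + ∑ a ∈ runStarts T, (n + a) -
        if 0 ∈ S ∨ 0 ∈ T then n else 0 := by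
  classical
  set φ : ℤ → ℤ := fun c => if ∃ k, q k = c + 1 then 0 else n + 1 + c with hφ
  have key := sum_isMaya h hP φ
  have h1 : ∀ k, φ (q k) = if 0 < ω k then n + 1 + q k else 0 := fun k => by
    have : (∃ k', q k' = q k + 1) ↔ ¬ 0 < ω k := by
      constructor
      · rintro ⟨k', hk'⟩ h0
        have h3 : k < k' := h.strictMono.lt_iff_lt.1 (by omega)
        have h4 := h.strictMono.monotone (Nat.succ_le_of_lt h3)
        rw [Nat.succ_eq_add_one, h.succ] at h4
        omega
      · intro h0
        exact ⟨k + 1, by rw [h.succ]; omega⟩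
    simp only [hφ, this]
    split_ifs <;> rfl
  have h2 : ∀ a : ℕ, φ a = if a + 1 ∈ T then n + ((a + 1 : ℕ) : ℤ) else 0 := fun a => by
    have hex : (∃ k, q k = (a : ℤ) + 1) ↔ a + 1 ∉ T := by
      rw [hP.exists_eq_iff, if_neg (by omega), show ((a : ℤ) + 1).toNat = a + 1 by omega]
    simp only [hφ, hex]
    by_cases ha : a + 1 ∈ T
    · simp [ha]; ring
    · simp [ha]
  have h3 : ∀ b ∈ S, φ (-(b : ℤ) - 1) = (if b ∈ runStarts S then n - b else 0) +
      if b = 0 then (if 0 ∈ T then 0 else -n) else 0 := fun b hb => by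
    simp only [hφ, hP.exists_eq_iff]
    rcases b with _ | b
    · have : (0 : ℕ) ∈ runStarts S := mem_runStarts.2 ⟨hb, fun c _ => by omega⟩
      by_cases h0 : 0 ∈ T <;> simp [h0, this]
    · have hst : b + 1 ∈ runStarts S ↔ b ∉ S := by
        rw [mem_runStarts]
        constructor
        · intro hc hbS
          exact hc.2 b hbS rfl
        · intro hbS
          exact ⟨hb, fun c hc hcb => hbS (by rwa [show b = c by omega])⟩
      have hneg : -((b + 1 : ℕ) : ℤ) - 1 + 1 < 0 := by omega
      simp only [if_pos hneg, show (-(-((b + 1 : ℕ) : ℤ) - 1 + 1) - 1).toNat = b by omega]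
      by_cases hbS : b ∈ S
      · simp [hst, hbS]
      · simp [hst, hbS]; ring
  have hT : T ⊆ Finset.range (N + 1) := fun a ha => by
    rw [Finset.mem_range]
    by_contra! hN
    exact (hP.mem_snd a).1 ha a (h.eq_self a (by omega))
  have h4 : ∑ k ∈ Finset.range N, (if k + 1 ∈ T then n + ((k + 1 : ℕ) : ℤ) else 0) +
      (if 0 ∈ T then n else 0) = ∑ a ∈ T, (n + (a : ℤ)) := by
    have := Finset.sum_range_succ' (fun k : ℕ => if k ∈ T then n + (k : ℤ) else 0) N
    rw [← Finset.sum_filter, Finset.filter_mem_eq_inter, Finset.inter_eq_right.2 hT] at this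
    rw [this]
    simp
  have h5 := sum_runStarts_add T fun a => n + (a : ℤ)
  have h6 : ∑ b ∈ S, (if b ∈ runStarts S then n - (b : ℤ) else 0) =
      ∑ b ∈ runStarts S, (n - (b : ℤ)) := by
    rw [← Finset.sum_filter, Finset.filter_mem_eq_inter,
      Finset.inter_eq_right.2 (runStarts_subset S)]
  simp only [h1, h2] at key
  rw [Finset.sum_congr rfl h3, Finset.sum_add_distrib, h6, Finset.sum_ite_eq'] at key
  by_cases hS0 : 0 ∈ S <;> by_cases hT0 : 0 ∈ T <;> simp [hS0, hT0] at key h4 h5 ⊢ <;> linarith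

lemma config_eq_mayaWeight {ω : ℕ → ℕ} {q : ℕ → ℤ} {N : ℕ} (h : IsProfile ω q N)
    {P : Finset ℕ × Finset ℕ} (hP : IsMaya q P) (n : ℤ) (Q : ℝ) {y : ℝ} (hy : y ≠ 0) :
    ∏ k ∈ Finset.range N, (y ^ (if 0 < ω k then n + 1 + q k else 0) * Q ^ ((k + 1) * ω k)) =
      mayaWeight n Q y P := by
  obtain ⟨S, T⟩ := P
  have hz : ∀ (s : Finset ℕ) (f : ℕ → ℤ), ∏ k ∈ s, y ^ f k = y ^ (∑ k ∈ s, f k) := fun s f => by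
    classical
    induction s using Finset.induction_on with
    | empty => simp
    | insert a s ha ih => rw [Finset.prod_insert ha, Finset.sum_insert ha, zpow_add₀ hy, ih]
  rw [Finset.prod_mul_distrib, hz, Finset.prod_pow_eq_pow_sum, exponent_isMaya h hP,
    energy_isMaya h hP]
  have he : ∑ b ∈ runStarts S, (n - b) + ∑ a ∈ runStarts T, (n + a) -
        (if 0 ∈ S ∨ 0 ∈ T then n else 0) =
      n * ((runStarts S).card + (runStarts T).card) + -((∑ b ∈ runStarts S, b : ℕ) : ℤ) +
        ((∑ a ∈ runStarts T, a : ℕ) : ℤ) + (if 0 ∈ S ∨ 0 ∈ T then -n else 0) := by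
    rw [Finset.sum_sub_distrib, Finset.sum_add_distrib]
    simp only [Finset.sum_const, nsmul_eq_mul]
    push_cast
    split_ifs <;> ring
  rw [he, zpow_add₀ hy, zpow_add₀ hy, zpow_add₀ hy, zpow_neg, zpow_natCast, zpow_natCast]
  simp only [mayaWeight, freeWeight, if_pos (card_isMaya h hP), runWeight, pow_add, inv_pow]
  split_ifs
  · ring
  · rw [zpow_zero]; ring

/-- The particle positions are `q k = k - ∑_{j ≥ k} ω j`, so that the exponent of `y` at the site
`-(k + 1)` is `n + 1 + q k`. -/
lemma exists_isProfile {z : NegInt → ℕ} (hz : z ∈ Omega) (n : ℤ) (Q y : ℝ) :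
    ∃ q N, IsProfile (occ z) q N ∧ configWeight n Q y z = ∏ k ∈ Finset.range N,
      (y ^ (if 0 < occ z k then n + 1 + q k else 0) * Q ^ ((k + 1) * occ z k)) := by
  obtain ⟨N, hN⟩ := hz
  have h0 : ∀ k, (N : ℕ) ≤ k → occ z k = 0 := fun k hk => hN _ (by
    rw [← PNat.coe_le_coe, Nat.succPNat_coe]; omega)
  refine ⟨fun k => k - ∑ j ∈ Finset.Ico k N, (occ z j : ℤ), N, ⟨fun k hk => ?_, fun k => ?_⟩, ?_⟩
  · simp [Finset.Ico_eq_empty_of_le hk]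
  · rcases lt_or_ge k N with hk | hk
    · rw [Finset.sum_eq_sum_Ico_succ_bot hk]
      push_cast
      ring
    · rw [Finset.Ico_eq_empty_of_le hk, Finset.Ico_eq_empty_of_le (by omega), h0 k hk]
      simp
  · have htail : ∀ k : ℕ, ∑ᶠ (j : ℕ+) (_ : k.succPNat ≤ j), (z (site j) : ℤ) =
        ∑ j ∈ Finset.Ico k N, (occ z j : ℤ) := fun k => by
      rw [← finsum_comp_equiv Equiv.pnatEquivNat.symm]
      rw [finsum_eq_sum_of_support_subset (s := Finset.Ico k N)]
      · refine Finset.sum_congr rfl fun j hj => ?_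
        rw [finsum_eq_if, if_pos]
        · rfl
        · exact Nat.succPNat_le_succPNat.2 (Finset.mem_Ico.1 hj).1
      · intro j hj
        rw [Function.mem_support, finsum_eq_if] at hj
        simp only [ne_eq, ite_eq_right_iff, not_forall] at hj
        obtain ⟨h1, h2⟩ := hj
        rw [Finset.coe_Ico, Set.mem_Ico]
        refine ⟨Nat.succPNat_le_succPNat.1 h1, ?_⟩
        by_contra! hjN
        exact h2 (by exact_mod_cast h0 j hjN)
    rw [configWeight, ← finprod_comp_equiv Equiv.pnatEquivNat.symm,
      finprod_eq_prod_of_mulSupport_subset (s := Finset.range N)]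
    · refine Finset.prod_congr rfl fun k _ => ?_
      change y ^ ((if 0 < z (site k.succPNat) then 1 else 0) * (n + ((k.succPNat : ℕ) : ℤ) -
        ∑ᶠ (j : ℕ+) (_ : k.succPNat ≤ j), (z (site j) : ℤ))) *
          Q ^ ((k.succPNat : ℕ) * z (site k.succPNat)) = _
      rw [htail, Nat.succPNat_coe, Nat.succ_eq_add_one]
      simp only [occ, ite_mul, one_mul, zero_mul]
      congr 2
      push_cast
      congr 1
      ring
    · intro k hk
      rw [Finset.coe_range, Set.mem_Iio]
      by_contra! hkN
      apply hk
      have hzk : z (site k.succPNat) = 0 := h0 k hkN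
      simp [hzk]

/-! ### Configurations correspond to Maya diagrams -/

lemma exists_site (s : NegInt) : ∃ k : ℕ, site k.succPNat = s := by
  obtain ⟨c, hc⟩ := s
  refine ⟨(-c - 1).toNat, Subtype.ext ?_⟩
  simp only [site, Nat.succPNat_coe]
  omega

lemma occ_injective : Function.Injective occ := fun z z' h => funext fun s => by
  obtain ⟨k, rfl⟩ := exists_site s
  exact congrFun h k

/-- The particles of a Maya diagram with as many particles on the negative side as holes on the
nonnegative side are listed by a sequence that eventually agrees with the ground state. -/
lemma exists_config {P : Finset ℕ × Finset ℕ} (hP : P.2.card = P.1.card) :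
    ∃ z ∈ Omega, ∃ q N, IsProfile (occ z) q N ∧ IsMaya q P := by
  classical
  obtain ⟨S, T⟩ := P
  obtain ⟨B, hB⟩ := S.exists_nat_subset_range
  obtain ⟨N, hN⟩ := T.exists_nat_subset_range
  -- the diagram, moved to the right by `B` so that it lies in `ℕ`
  set p : ℕ → Prop := fun m => (m < B ∧ B - 1 - m ∈ S) ∨ (B ≤ m ∧ m - B ∉ T) with hp
  have hpN : ∀ k, N ≤ k → p (B + k) := fun k hk => by
    refine Or.inr ⟨by omega, fun hm => ?_⟩
    have := Finset.mem_range.1 (hN hm)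
    omega
  have hinf : (Set.ofPred p).Infinite := Set.infinite_of_forall_exists_gt fun a =>
    ⟨B + (N + a + 1), hpN _ (by omega), by omega⟩
  have hcount : ∀ k, N ≤ k → Nat.count p (B + k) = k := fun k hk => by
    rw [Nat.count_add, Nat.count_eq_card_filter_range, Nat.count_eq_card_filter_range]
    have h1 : (Finset.range B).filter p = S.image (B - 1 - ·) := by
      ext m
      simp only [Finset.mem_filter, Finset.mem_range, Finset.mem_image, hp]
      constructor
      · rintro ⟨h1, h2 | h2⟩
        · exact ⟨_, h2.2, by omega⟩
        · omega
      · rintro ⟨b, hb, rfl⟩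
        have := Finset.mem_range.1 (hB hb)
        exact ⟨by omega, Or.inl ⟨by omega, by rwa [show B - 1 - (B - 1 - b) = b by omega]⟩⟩
    have h2 : (Finset.range k).filter (fun i => p (B + i)) = Finset.range k \ T := by
      ext m
      simp [hp]
    have h3 : T ⊆ Finset.range k := hN.trans (Finset.range_subset_range.2 hk)
    rw [h1, h2, Finset.card_sdiff_of_subset h3, Finset.card_image_of_injOn, Finset.card_range]
    · have := Finset.card_le_card h3
      simp only [Finset.card_range] at this hP
      omega
    · intro a ha b hb hab
      have h4 := Finset.mem_range.1 (hB ha)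
      have h5 := Finset.mem_range.1 (hB hb)
      simp only at hab
      omega
  set q : ℕ → ℤ := fun k => (Nat.nth p k : ℤ) - B with hq
  have hmono : StrictMono (Nat.nth p) := Nat.nth_strictMono hinf
  have hqN : ∀ k, N ≤ k → q k = k := fun k hk => by
    have := Nat.nth_count (hpN k hk)
    rw [hcount k hk] at this
    simp [hq, this]
  have hrange : ∀ m, p m ↔ ∃ k, Nat.nth p k = m := fun m =>
    ⟨fun hm => ⟨_, Nat.nth_count hm⟩, fun ⟨k, hk⟩ => hk ▸ Nat.nth_mem_of_infinite hinf k⟩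
  set z : NegInt → ℕ := fun s =>
    (q ((-s.1 - 1).toNat + 1) - q (-s.1 - 1).toNat - 1).toNat with hz
  have hocc : ∀ k, occ z k = (q (k + 1) - q k - 1).toNat := fun k => by
    simp only [occ, hz, site, Nat.succPNat_coe]
    rw [show (- -((k.succ : ℕ) : ℤ) - 1).toNat = k by omega]
  have hprof : IsProfile (occ z) q N := ⟨hqN, fun k => by
    have h1 := hmono (Nat.lt_succ_self k)
    rw [hocc]
    simp only [hq, Nat.succ_eq_add_one] at h1 ⊢
    omega⟩
  refine ⟨z, ⟨N.succPNat, fun i hi => ?_⟩, q, N, hprof, fun b => ?_, fun a => ?_⟩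
  · obtain ⟨k, rfl⟩ : ∃ k : ℕ, k.succPNat = i := ⟨i.natPred, PNat.succPNat_natPred i⟩
    have hk : N ≤ k := Nat.succPNat_le_succPNat.1 hi
    change occ z k = 0
    have h1 := hprof.succ k
    rw [hqN k hk, hqN (k + 1) (by omega)] at h1
    push_cast at h1
    omega
  · constructor
    · intro hb
      have h1 := Finset.mem_range.1 (hB hb)
      obtain ⟨k, hk⟩ := (hrange (B - 1 - b)).1 (Or.inl ⟨by omega, by
        rwa [show B - 1 - (B - 1 - b) = b by omega]⟩)
      exact ⟨k, by simp only [hq]; omega⟩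
    · rintro ⟨k, hk⟩
      simp only [hq] at hk
      rcases (hrange _).2 ⟨k, rfl⟩ with h1 | h1
      · rw [show b = B - 1 - Nat.nth p k by omega]
        exact h1.2
      · omega
  · constructor
    · intro ha k hk
      simp only [hq] at hk
      rcases (hrange _).2 ⟨k, rfl⟩ with h1 | h1
      · omega
      · exact h1.2 (by rwa [show Nat.nth p k - B = a by omega])
    · intro ha
      by_contra haT
      obtain ⟨k, hk⟩ := (hrange (B + a)).1 (Or.inr ⟨by omega, by simpa using haT⟩)
      exact ha k (by simp only [hq]; omega)

lemma hasSum_configWeight (n : ℤ) (Q : ℝ) {y s : ℝ} (hy : y ≠ 0)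
    (hs : HasSum (mayaWeight n Q y) s) :
    HasSum (fun z : Omega => configWeight n Q y z) s := by
  have hex : ∀ z : Omega, ∃ P q N, IsProfile (occ z) q N ∧ IsMaya q P ∧
      configWeight n Q y z = mayaWeight n Q y P := fun z => by
    obtain ⟨q, N, h, hw⟩ := exists_isProfile z.2 n Q y
    obtain ⟨P, hP⟩ := h.exists_isMaya
    exact ⟨P, q, N, h, hP, hw.trans (config_eq_mayaWeight h hP n Q hy)⟩
  choose Φ q N hprof hmaya hw using hex
  have hinj : Function.Injective Φ := fun z z' hzz => by
    have hq : q z = q z' := ((hprof z).strictMono.range_inj (hprof z').strictMono).1 <| by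
      ext c
      rw [Set.mem_range, Set.mem_range, (hmaya z).exists_eq_iff, (hmaya z').exists_eq_iff, hzz]
    refine Subtype.ext (occ_injective (funext fun k => ?_))
    have h1 := (hprof z).succ k
    have h2 := (hprof z').succ k
    rw [hq] at h1
    omega
  refine ((hinj.hasSum_iff fun P hP => ?_).2 hs).congr_fun hw
  rw [mayaWeight, freeWeight, if_neg, zero_mul]
  intro hc
  obtain ⟨z, hz, q', N', h', hP'⟩ := exists_config hc
  refine hP ⟨⟨z, hz⟩, (hmaya ⟨z, hz⟩).unique ?_⟩
  rwa [(hprof ⟨z, hz⟩).unique h']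

end IsingIdentity

theorem theorem2 (n : ℤ) (Q y : ℝ) (hQ₀ : 0 < Q) (hQ₁ : Q < 1) (hQy : Q < y) (hy : y ≤ 1) :
    Summable (fun z : IsingIdentity.Omega => IsingIdentity.configWeight n Q y z) ∧
    Summable (IsingIdentity.runFamily n Q y) ∧
    IsingIdentity.Zn n Q y =
      ∑' z : IsingIdentity.Omega, IsingIdentity.configWeight n Q y z := by
  obtain ⟨r, hr, hm⟩ := IsingIdentity.hasSum_runFamily n hQ₀ hQy hy
  have hz := IsingIdentity.hasSum_configWeight n Q (hQ₀.trans hQy).ne' hm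
  exact ⟨hz.summable, hr.summable, by rw [IsingIdentity.Zn, hr.tsum_eq, hz.tsum_eq]⟩
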